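/- Let $X$ be a real Hilbert space, let $A\colon X\to 2^X$ be maximally monotone, and let $B\colon X\to X$ be monotone and $\beta$-Lipschitzian for some $\beta\in\,]0,+\infty[$. Let $\alpha,\chi\in\,]0,+\infty[$ and $\varepsilon\in\,]0,\alpha/(\beta+1)[$. For every $n\in\mathbb N$, let $W_n\colon X\to X$ be $\alpha$-strongly monotone, i.e. $\langle x-y, W_nx-W_ny\rangle\ge\alpha\|x-y\|^2$ for all $x,y\in X$, and $\chi$-Lipschitzian, and let $\gamma_n\in[\varepsilon,(\alpha-\varepsilon)/\beta]$. Let $(\lambda_n)_{n\in\mathbb N}$ be a sequence in $]0,2[$ with $0<\inf_n\lambda_n\le\sup_n\lambda_n<2$, let $(e_n)_{n\in\mathbb N}$ be a sequence in $X$ with $e_n\to0$, let $m\in\mathbb N\smallsetminus\{0\}$, and let $(\mu_{n,j})_{n\in\mathbb N,\,0\le j\le n}$ be a real array such that (a) $\mu_{n,j}=0$ for all integers $n>m$ and $0\le j\le n-m-1$; (b) $\sum_{j=0}^n\mu_{n,j}=1$ for every $n\in\mathbb N$; (c) $\sup_{n\in\mathbb N}\max_{0\le j\le n}|\mu_{n,j}|<+\infty$.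 Then, for every $n\in\mathbb N$, the operator $(W_n+\gamma_nA)^{-1}$ is single-valued and defined on all of $X$. Hence, given $x_0\in X$, the following iteration is well defined: for $n=0,1,\ldots$ $$\begin{aligned} \widetilde x_n&=e_n+\sum_{j=0}^n\mu_{n,j}x_j,\qquad v_n^*=W_n\widetilde x_n-\gamma_nB\widetilde x_n,\\ y_n&=(W_n+\gamma_nA)^{-1}v_n^*,\qquad y_n^*=\gamma_n^{-1}(v_n^*-W_ny_n)+By_n,\\ x_{n+1}&=\begin{cases}x_n+\dfrac{\lambda_n\langle y_n-x_n,y_n^*\rangle}{\|y_n^*\|^2}\,y_n^*,&\text{if }\langle y_n-x_n,y_n^*\rangle<0;\\ x_n,&\text{otherwise.}\end{cases} \end{aligned}$$ Suppose moreover that $\operatorname{zer}(A+B)=\{x\in X: 0\in Ax+Bx\}\ne\varnothing$. Then, for every $x_0\in X$: (i) $\sum_{n\in\mathbb N}\|x_{n+1}-x_n\|^2<+\infty$; (ii) $(x_n)_{n\in\mathbb N}$ converges weakly to a point in $\operatorname{zer}(A+B)$. -/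

import Mathlib

open Filter Topology Set
open scoped NNReal Pointwise

/-! Set-valued operators on a real Hilbert space `X` are functions `X → Set X`; sums and real
multiples of them are taken pointwise, `(M + N) x = M x + N x` and `(c • M) x = c • M x`. -/

namespace SetOp

variable {X : Type*} [NormedAddCommGroup X] [InnerProductSpace ℝ X]

/-- A single-valued operator, seen as a set-valued one. -/
def single (T : X → X) : X → Set X := fun x => {T x}

/-- The graph of a set-valued operator. -/
def gra (M : X → Set X) : Set (X × X) := {p | p.2 ∈ M p.1}

/-- The set of zeros of a set-valued operator. -/
def zer (M : X → Set X) : Set X := {x | (0 : X) ∈ M x}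

/-- The set-valued inverse of a set-valued operator. -/
def inverse (M : X → Set X) : X → Set X := fun u => {x | u ∈ M x}

/-- Monotonicity of a set-valued operator. -/
def IsMonotone (M : X → Set X) : Prop :=
  ∀ p ∈ gra M, ∀ q ∈ gra M, 0 ≤ inner ℝ (p.1 - q.1) (p.2 - q.2)

/-- Maximal monotonicity: `M` is monotone and no monotone operator has a strictly larger graph. -/
def IsMaximallyMonotone (M : X → Set X) : Prop :=
  IsMonotone M ∧ ∀ N : X → Set X, IsMonotone N → gra M ⊆ gra N → gra N = gra M

/-- Strong monotonicity of a single-valued operator, with constant `α`. -/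
def IsStronglyMonotone (α : ℝ) (T : X → X) : Prop :=
  ∀ x y : X, α * ‖x - y‖ ^ 2 ≤ inner ℝ (x - y) (T x - T y)

/-- The sequences `x`, `xt`, `v`, `y`, `ys` (for `xₙ`, `x̃ₙ`, `vₙ*`, `yₙ`, `yₙ*`) are generated by
the perturbed forward-backward-forward algorithm with memory. -/
structure IsFBFIteration (A : X → Set X) (B : X → X) (W : ℕ → X → X) (γ lam : ℕ → ℝ)
    (e : ℕ → X) (μ : ℕ → ℕ → ℝ) (x xt v y ys : ℕ → X) : Prop where
  xt_eq : ∀ n, xt n = e n + ∑ j ∈ Finset.range (n + 1), μ n j • x j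
  v_eq : ∀ n, v n = W n (xt n) - γ n • B (xt n)
  y_mem : ∀ n, y n ∈ inverse (single (W n) + γ n • A) (v n)
  ys_eq : ∀ n, ys n = (γ n)⁻¹ • (v n - W n (y n)) + B (y n)
  x_step : ∀ n, inner ℝ (y n - x n) (ys n) < 0 →
    x (n + 1) = x n + (lam n * inner ℝ (y n - x n) (ys n) / ‖ys n‖ ^ 2) • ys n
  x_stay : ∀ n, ¬ inner ℝ (y n - x n) (ys n) < 0 → x (n + 1) = x n

end SetOp

namespace SetOp

variable {X : Type*} [NormedAddCommGroup X] [InnerProductSpace ℝ X]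

/-! Since `ys n` lies in `(A + B) (y n)`, monotonicity puts every zero `z` in the half-space `⟨y n -
z, ys n⟩ ≤ 0` with sign reversed, that is `0 ≤ ⟨y n - z, ys n⟩`. The update is a relaxed projection
onto this half-space, so `x` is Fejér monotone with square-summable steps
(`relaxed_projection_norm_sq_le`). Vanishing steps and finite memory give `xt n - x n → 0`
(`tendsto_sum_memory_sub`). The bounds on `γ n` make `⟨xt n - y n, ys n⟩` at least a multiple of
`‖xt n - y n‖²`, while the step length controls `⟨x n - y n, ys n⟩`; hence `xt n - y n → 0` and `ys
n → 0`. Weak cluster points are then zeros of `A + B`, and Opial's lemma concludes. Well-definedness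
combines Minty's theorem with Banach's fixed point theorem (`exists_map_add_smul_eq`). -/

/-! ### Minty's theorem by minimization over a convex hull. -/

theorem norm_sq_convex_combination {X : Type*} [NormedAddCommGroup X] [InnerProductSpace ℝ X]
    (a b : X) (t : ℝ) :
    ‖(1 - t) • a + t • b‖ ^ 2 = (1 - t) * ‖a‖ ^ 2 + t * ‖b‖ ^ 2 - t * (1 - t) * ‖a - b‖ ^ 2 := by
  simp only [← real_inner_self_eq_norm_sq, inner_add_left, inner_add_right, inner_sub_left,
    inner_sub_right, real_inner_smul_left, real_inner_smul_right, real_inner_comm a b]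
  ring

/-- A nonnegative function of the form `‖c p‖² + s p` on a convex set admits a point `x` which
behaves as the value of `c` at a minimizer. -/
theorem exists_norm_sub_sq_le {X E : Type*} [NormedAddCommGroup X] [InnerProductSpace ℝ X]
    [CompleteSpace X] [AddCommGroup E] [Module ℝ E]
    (c : E →ₗ[ℝ] X) (s : E →ₗ[ℝ] ℝ) {K : Set E} (hK : Convex ℝ K)
    (h0 : ∀ p ∈ K, 0 ≤ ‖c p‖ ^ 2 + s p) :
    ∃ x : X, ∀ p ∈ K, ‖x - c p‖ ^ 2 ≤ ‖c p‖ ^ 2 + s p := by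
  rcases K.eq_empty_or_nonempty with rfl | hne
  · exact ⟨0, by simp⟩
  set φ : E → ℝ := fun p => ‖c p‖ ^ 2 + s p with hφ
  set d := sInf (φ '' K) with hd
  have hbdd : BddBelow (φ '' K) := ⟨0, by rintro _ ⟨p, hp, rfl⟩; exact h0 p hp⟩
  have hd0 : 0 ≤ d := Real.sInf_nonneg (by rintro _ ⟨p, hp, rfl⟩; exact h0 p hp)
  have hdle : ∀ p ∈ K, d ≤ φ p := fun p hp => csInf_le hbdd ⟨p, hp, rfl⟩
  have key : ∀ p ∈ K, ∀ q ∈ K, ∀ t ∈ Icc (0 : ℝ) 1,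
      t * (1 - t) * ‖c p - c q‖ ^ 2 ≤ (1 - t) * (φ p - d) + t * (φ q - d) := by
    intro p hp q hq t ht
    have hmem : (1 - t) • p + t • q ∈ K := hK hp hq (by linarith [ht.2]) ht.1 (by ring)
    have h1 := hdle _ hmem
    simp only [hφ, map_add, map_smul, norm_sq_convex_combination, smul_eq_mul] at h1 ⊢
    linarith
  have hseq : ∀ k : ℕ, ∃ p ∈ K, φ p < d + 1 / ((k : ℝ) + 1) := by
    intro k
    obtain ⟨_, ⟨p, hp, rfl⟩, h⟩ := exists_lt_of_csInf_lt (hne.image φ)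
      (show sInf (φ '' K) < d + 1 / ((k : ℝ) + 1) by
        have : (0 : ℝ) < 1 / ((k : ℝ) + 1) := by positivity
        linarith)
    exact ⟨p, hp, h⟩
  choose p hpK hp using hseq
  have h1n : Tendsto (fun k : ℕ => 1 / ((k : ℝ) + 1)) atTop (𝓝 0) :=
    tendsto_one_div_add_atTop_nhds_zero_nat
  have hφp : Tendsto (fun k => φ (p k) - d) atTop (𝓝 0) :=
    squeeze_zero (fun k => sub_nonneg.2 (hdle _ (hpK k))) (fun k => by linarith [hp k]) h1n
  -- Strong convexity at the midpoint makes the images of a minimizing sequence Cauchy, although the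
  -- `p k` themselves need not converge.
  have hcau : CauchySeq fun k => c (p k) := by
    refine cauchySeq_of_le_tendsto_0 (fun k : ℕ => √(4 * (1 / ((k : ℝ) + 1)))) ?_ ?_
    · intro i j N hi hj
      rw [dist_eq_norm]
      apply Real.le_sqrt_of_sq_le
      have h := key _ (hpK i) _ (hpK j) (1 / 2) (by norm_num)
      have hi' : 1 / ((i : ℝ) + 1) ≤ 1 / ((N : ℝ) + 1) := by gcongr
      have hj' : 1 / ((j : ℝ) + 1) ≤ 1 / ((N : ℝ) + 1) := by gcongr
      linarith [hp i, hp j]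
    · have := (Real.continuous_sqrt.tendsto _).comp (h1n.const_mul 4)
      rwa [mul_zero, Real.sqrt_zero] at this
  obtain ⟨x, hx⟩ := cauchySeq_tendsto_of_complete hcau
  refine ⟨x, fun q hq => ?_⟩
  have hlim : ∀ t ∈ Icc (0 : ℝ) 1, t * (1 - t) * ‖x - c q‖ ^ 2 ≤ t * (φ q - d) := by
    intro t ht
    have hl := (((hx.sub_const (c q)).norm.pow 2).const_mul (t * (1 - t)))
    have hr := (hφp.const_mul (1 - t)).add_const (t * (φ q - d))
    rw [mul_zero, zero_add] at hr
    exact le_of_tendsto_of_tendsto' hl hr fun k => key _ (hpK k) _ hq t ht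
  have hF : 0 ≤ φ q - d := sub_nonneg.2 (hdle _ hq)
  set D := ‖x - c q‖ ^ 2
  -- Dividing `hlim` by `t` and letting `t → 0` would give the claim; one small explicit `t` yields
  -- the contradiction directly.
  by_contra! hcon
  have hD : φ q - d < D := by simp only [hφ] at *; linarith
  have hDpos : 0 < D := by linarith
  set t := (D - (φ q - d)) / (2 * D) with ht
  have ht0 : 0 < t := div_pos (by linarith) (by linarith)
  have htD : t * D = (D - (φ q - d)) / 2 := by rw [ht]; field_simp
  have ht1 : t ≤ 1 := by rw [ht, div_le_one (by linarith)]; linarith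
  have h := hlim t ⟨ht0.le, ht1⟩
  rw [mul_assoc] at h
  have h' := le_of_mul_le_mul_left h ht0
  nlinarith

/-- Any monotone subset of `X × X` is monotonically related to a point of the graph of `-Id`. -/
theorem exists_forall_inner_add_nonneg [CompleteSpace X] (G : Set (X × X))
    (hG : ∀ p ∈ G, ∀ q ∈ G, 0 ≤ inner ℝ (p.1 - q.1) (p.2 - q.2)) :
    ∃ x : X, ∀ p ∈ G, 0 ≤ inner ℝ (p.1 - x) (p.2 + x) := by
  -- The third coordinate linearizes the inner product, so that `F`, which equals `⟨p.1 - q.1, p.2 -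
  -- q.2⟩` on lifted pairs, is affine in each argument and its sign passes to the convex hull.
  set g : X × X → X × X × ℝ := fun p => (p.1, p.2, inner ℝ p.1 p.2) with hg
  set S := g '' G with hS
  set F : X × X × ℝ → X × X × ℝ → ℝ :=
    fun p q => p.2.2 + q.2.2 - inner ℝ p.1 q.2.1 - inner ℝ q.1 p.2.1 with hF
  have hFs : ∀ p q, F p q = F q p := fun p q => by simp only [hF]; ring
  have hconv : ∀ q, Convex ℝ {p | 0 ≤ F p q} := by
    intro q p hp r hr a b ha hb hab
    have : F (a • p + b • r) q = a * F p q + b * F r q := by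
      obtain rfl : b = 1 - a := by linarith
      simp only [hF, Prod.fst_add, Prod.snd_add, Prod.smul_fst, Prod.smul_snd, smul_eq_mul,
        inner_add_left, inner_add_right, real_inner_smul_left, real_inner_smul_right]
      ring
    simp only [mem_ofPred_eq] at hp hr ⊢
    rw [this]
    positivity
  have h1 : ∀ q ∈ S, ∀ p ∈ convexHull ℝ S, 0 ≤ F p q := by
    rintro _ ⟨q, hq, rfl⟩
    refine fun p hp => convexHull_min ?_ (hconv _) hp
    rintro _ ⟨p, hp, rfl⟩
    have := hG p hp q hq
    simp only [inner_sub_left, inner_sub_right] at this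
    simp only [hF, hg, mem_ofPred_eq]
    linarith
  have h2 : ∀ p ∈ convexHull ℝ S, ∀ q ∈ convexHull ℝ S, 0 ≤ F q p := by
    refine fun p hp q hq => convexHull_min ?_ (hconv _) hq
    intro r hr
    rw [mem_ofPred_eq, hFs]
    exact h1 r hr p hp
  -- Completing the square turns the goal into `‖x - (p.1 - p.2)/2‖² ≤ ‖(p.1 - p.2)/2‖² + ⟨p.1,
  -- p.2⟩`. On the hull, `0 ≤ F p p` bounds the right side below by `‖(p.1 + p.2)/2‖²`.
  let c : X × X × ℝ →ₗ[ℝ] X := (1 / 2 : ℝ) • (LinearMap.fst ℝ X (X × ℝ) -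
    LinearMap.fst ℝ X ℝ ∘ₗ LinearMap.snd ℝ X (X × ℝ))
  let s : X × X × ℝ →ₗ[ℝ] ℝ := LinearMap.snd ℝ X ℝ ∘ₗ LinearMap.snd ℝ X (X × ℝ)
  have hc : ∀ p, c p = (1 / 2 : ℝ) • (p.1 - p.2.1) := fun p => rfl
  have hs : ∀ p, s p = p.2.2 := fun p => rfl
  obtain ⟨x, hx⟩ := exists_norm_sub_sq_le c s (convex_convexHull ℝ S) (by
    intro p hp
    have h := h2 p hp p hp
    have h3 := sq_nonneg ‖(1 / 2 : ℝ) • (p.1 + p.2.1)‖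
    simp only [hc, hs, hF, norm_smul, mul_pow, norm_add_sq_real, norm_sub_sq_real] at h h3 ⊢
    norm_num at h h3 ⊢
    linarith)
  refine ⟨x, fun p hp => ?_⟩
  have h := hx _ (subset_convexHull ℝ S ⟨p, hp, rfl⟩)
  rw [norm_sub_sq_real, hc, hs] at h
  simp only [hg, real_inner_smul_right, inner_sub_right, ← real_inner_self_eq_norm_sq] at h
  simp only [inner_sub_left, inner_add_right, real_inner_comm x p.1]
  linarith

theorem IsMaximallyMonotone.mem_of_forall {A : X → Set X} (hA : IsMaximallyMonotone A) {x u : X}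
    (h : ∀ y, ∀ v ∈ A y, 0 ≤ inner ℝ (x - y) (u - v)) : u ∈ A x := by
  have hmem : ∀ y v, v ∈ A y ∨ (y = x ∧ v = u) ↔ (y, v) ∈ insert (x, u) (gra A) := by
    intro y v
    simp [gra, or_comm]
  have hN : IsMonotone (fun y => {v | v ∈ A y ∨ (y = x ∧ v = u)}) := by
    rintro ⟨y, v⟩ hp ⟨y', v'⟩ hq
    rcases hp with hp | ⟨rfl, rfl⟩ <;> rcases hq with hq | ⟨hq1, hq2⟩
    · exact hA.1 _ hp _ hq
    · dsimp at hq1 hq2 ⊢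
      subst hq1 hq2
      have := h _ _ hp
      rwa [← neg_sub, ← neg_sub v, inner_neg_neg] at this
    · exact h _ _ hq
    · dsimp at hq1 hq2 ⊢
      subst hq1 hq2
      simp
  have := hA.2 _ hN (fun p hp => Or.inl hp)
  have hx : (x, u) ∈ gra (fun y => {v | v ∈ A y ∨ (y = x ∧ v = u)}) := Or.inr ⟨rfl, rfl⟩
  rw [this] at hx
  exact hx

/-- Minty's theorem: `Id + c A` is surjective for a maximally monotone `A`. -/
theorem IsMaximallyMonotone.exists_add_smul_eq [CompleteSpace X] {A : X → Set X}
    (hA : IsMaximallyMonotone A) {c : ℝ} (hc : 0 < c) (u : X) :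
    ∃ p, ∃ a ∈ A p, p + c • a = u := by
  obtain ⟨x, hx⟩ := exists_forall_inner_add_nonneg
    ((fun p : X × X => (p.1, c • p.2 - u)) '' gra A) (by
      rintro _ ⟨p, hp, rfl⟩ _ ⟨q, hq, rfl⟩
      dsimp only
      rw [sub_sub_sub_cancel_right, ← smul_sub, real_inner_smul_right]
      exact mul_nonneg hc.le (hA.1 _ hp _ hq))
  refine ⟨x, c⁻¹ • (u - x), hA.mem_of_forall fun y v hv => ?_, by
    rw [smul_inv_smul₀ hc.ne']; abel⟩
  have h := hx _ ⟨(y, v), hv, rfl⟩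
  dsimp only at h
  have e : c • v - u + x = c • (v - c⁻¹ • (u - x)) := by
    rw [smul_sub, smul_inv_smul₀ hc.ne']; abel
  rw [e, real_inner_smul_right] at h
  have h' := nonneg_of_mul_nonneg_right h hc
  rwa [← neg_sub, ← neg_sub v, inner_neg_neg]

/-! ### Inverting `W + c A`, and zeros of `A + B`. -/

theorem IsMonotone.eq_of_add_smul_eq {A : X → Set X} (hA : IsMonotone A) {W : X → X} {α : ℝ}
    (hα : 0 < α) (hW : IsStronglyMonotone α W) {c : ℝ} (hc : 0 < c) {p q a b : X}
    (ha : a ∈ A p) (hb : b ∈ A q) (h : W p + c • a = W q + c • b) : p = q := by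
  have h1 := hA (p, a) ha (q, b) hb
  have h2 := hW p q
  have h3 : W p - W q = -(c • (a - b)) := by
    rw [smul_sub, neg_sub, sub_eq_sub_iff_add_eq_add, h, add_comm]
  rw [h3, inner_neg_right, real_inner_smul_right] at h2
  dsimp only at h1
  have h4 : ‖p - q‖ ^ 2 ≤ 0 := by
    by_contra! h5
    nlinarith [mul_nonneg hc.le h1, mul_pos hα h5]
  rw [← sub_eq_zero, ← norm_eq_zero]
  exact pow_eq_zero_iff two_ne_zero |>.1 (le_antisymm h4 (sq_nonneg _))

theorem IsMonotone.norm_sub_le {A : X → Set X} (hA : IsMonotone A) {c : ℝ} (hc : 0 < c)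
    {p q a b : X} (ha : a ∈ A p) (hb : b ∈ A q) :
    ‖p - q‖ ≤ ‖(p + c • a) - (q + c • b)‖ := by
  have h1 := mul_nonneg hc.le (hA (p, a) ha (q, b) hb)
  have h2 : (p + c • a) - (q + c • b) = (p - q) + c • (a - b) := by
    rw [smul_sub]; abel
  apply le_of_sq_le_sq _ (norm_nonneg _)
  rw [h2, norm_add_sq_real, real_inner_smul_right]
  nlinarith [sq_nonneg ‖c • (a - b)‖]

/-- Solutions are the fixed points of the forward-backward map `p ↦ J (p - t (W p - u))`, with `J`
the resolvent of `t c A`; it is a contraction for small `t`. -/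
theorem IsMaximallyMonotone.exists_map_add_smul_eq [CompleteSpace X] {A : X → Set X}
    (hA : IsMaximallyMonotone A) {W : X → X} {α : ℝ} (hα : 0 < α) (hW : IsStronglyMonotone α W)
    {χ : ℝ≥0} (hWlip : LipschitzWith χ W) {c : ℝ} (hc : 0 < c) (u : X) :
    ∃ p, ∃ a ∈ A p, W p + c • a = u := by
  -- a contraction constant `t` for the forward step
  obtain ⟨t, ht, k, hk0, hk1, hk⟩ : ∃ t : ℝ, 0 < t ∧ ∃ k : ℝ, 0 ≤ k ∧ k < 1 ∧
      1 - 2 * t * α + t ^ 2 * (χ : ℝ) ^ 2 ≤ k ^ 2 := by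
    have hD : (0 : ℝ) < (χ : ℝ) ^ 2 + α ^ 2 := by positivity
    -- The term `α²` in the denominator keeps it positive when `χ = 0` and the radicand below
    -- nonnegative.
    refine ⟨α / ((χ : ℝ) ^ 2 + α ^ 2), by positivity,
      √(1 - α ^ 2 / ((χ : ℝ) ^ 2 + α ^ 2)), Real.sqrt_nonneg _, ?_, ?_⟩
    · rw [Real.sqrt_lt' one_pos]
      have : 0 < α ^ 2 / ((χ : ℝ) ^ 2 + α ^ 2) := by positivity
      linarith
    · have h1 : α ^ 2 / ((χ : ℝ) ^ 2 + α ^ 2) ≤ 1 := by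
        rw [div_le_one hD]; nlinarith [sq_nonneg (χ : ℝ)]
      rw [Real.sq_sqrt (by linarith)]
      have h2 : (α / ((χ : ℝ) ^ 2 + α ^ 2)) ^ 2 * (χ : ℝ) ^ 2 ≤
          α ^ 2 / ((χ : ℝ) ^ 2 + α ^ 2) := by
        have : (α / ((χ : ℝ) ^ 2 + α ^ 2)) ^ 2 * (χ : ℝ) ^ 2 =
          α ^ 2 / ((χ : ℝ) ^ 2 + α ^ 2) * ((χ : ℝ) ^ 2 / ((χ : ℝ) ^ 2 + α ^ 2)) := by
          field_simp
        rw [this]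
        refine mul_le_of_le_one_right (by positivity) ?_
        rw [div_le_one hD]; nlinarith [sq_nonneg α]
      have h3 : 2 * (α / ((χ : ℝ) ^ 2 + α ^ 2)) * α = 2 * (α ^ 2 / ((χ : ℝ) ^ 2 + α ^ 2)) := by
        ring
      linarith
  have hres := fun w => hA.exists_add_smul_eq (mul_pos ht hc) w
  choose J a haJ hJ using hres
  have hcontr : ContractingWith k.toNNReal (fun p => J (p - t • (W p - u))) := by
    refine ⟨by rwa [Real.toNNReal_lt_one], LipschitzWith.of_dist_le_mul fun p q => ?_⟩
    rw [dist_eq_norm, dist_eq_norm, Real.coe_toNNReal _ hk0]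
    refine (hA.1.norm_sub_le (mul_pos ht hc) (haJ _) (haJ _)).trans ?_
    rw [hJ, hJ]
    apply le_of_sq_le_sq _ (by positivity)
    have e : p - t • (W p - u) - (q - t • (W q - u)) = (p - q) - t • (W p - W q) := by
      simp only [smul_sub]; abel
    have h1 := hW p q
    have h2 : ‖W p - W q‖ ≤ χ * ‖p - q‖ := by
      simpa [dist_eq_norm] using hWlip.dist_le_mul p q
    have h3 : ‖W p - W q‖ ^ 2 ≤ (χ * ‖p - q‖) ^ 2 := by gcongr
    rw [e, norm_sub_sq_real, real_inner_smul_right, norm_smul, mul_pow, Real.norm_eq_abs, sq_abs]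
    have h4 := mul_le_mul_of_nonneg_left h1 ht.le
    have h5 := mul_le_mul_of_nonneg_left h3 (sq_nonneg t)
    have h6 := mul_le_mul_of_nonneg_right hk (sq_nonneg ‖p - q‖)
    nlinarith
  have hfix := hcontr.fixedPoint_isFixedPt
  set p := ContractingWith.fixedPoint _ hcontr
  refine ⟨p, a (p - t • (W p - u)), ?_, ?_⟩
  · have := haJ (p - t • (W p - u))
    rwa [show J (p - t • (W p - u)) = p from hfix] at this
  · have := hJ (p - t • (W p - u))
    rw [show J (p - t • (W p - u)) = p from hfix, mul_smul, sub_eq_add_neg p (t • (W p - u)),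
      add_right_inj, ← sub_eq_add_neg, ← smul_neg] at this
    rw [smul_right_injective X ht.ne' this]; abel

theorem mem_inverse_single_add_smul {A : X → Set X} {W : X → X} {c : ℝ} {u p : X} :
    p ∈ inverse (single W + c • A) u ↔ ∃ a ∈ A p, W p + c • a = u := by
  simp only [inverse, single, mem_ofPred_eq, Pi.add_apply, Pi.smul_apply, singleton_add, mem_image,
    mem_smul_set, exists_exists_and_eq_and]

theorem mem_zer_add_single {X : Type*} [NormedAddCommGroup X] {A : X → Set X} {B : X → X} {x : X} :
    x ∈ zer (A + single B) ↔ -B x ∈ A x := by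
  simp [zer, single]

theorem isMonotone_single_iff {B : X → X} :
    IsMonotone (single B) ↔ ∀ x y, 0 ≤ inner ℝ (x - y) (B x - B y) := by
  constructor
  · intro h x y
    exact h (x, B x) rfl (y, B y) rfl
  · rintro h ⟨x, a⟩ (ha : a = B x) ⟨y, b⟩ (hb : b = B y)
    rw [ha, hb]
    exact h x y

/-- `A + B` inherits maximality from `A`, for a monotone Lipschitzian `B`. -/
theorem IsMaximallyMonotone.mem_zer_add_single [CompleteSpace X] {A : X → Set X}
    (hA : IsMaximallyMonotone A) {B : X → X} (hB : IsMonotone (single B)) {β : ℝ≥0}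
    (hBlip : LipschitzWith β B) {x : X}
    (h : ∀ p, ∀ a ∈ A p, 0 ≤ inner ℝ (x - p) (-(a + B p))) : x ∈ zer (A + single B) := by
  rw [SetOp.mem_zer_add_single]
  have hW : IsStronglyMonotone 1 (fun z => z + B z) := by
    intro y z
    have := isMonotone_single_iff.1 hB y z
    rw [show y + B y - (z + B z) = (y - z) + (B y - B z) by abel, inner_add_right,
      real_inner_self_eq_norm_sq]
    linarith
  -- Testing `h` at the resolvent point `p` of `A + B` at `x` gives `-‖x - p‖² ≥ 0`, so `x = p`.
  obtain ⟨p, a, ha, hp⟩ := hA.exists_map_add_smul_eq one_pos hW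
    (LipschitzWith.id.add hBlip) one_pos x
  have h1 : a + B p = x - p := by rw [← hp, one_smul]; abel
  have h2 := h p a ha
  rw [h1, inner_neg_right, real_inner_self_eq_norm_sq] at h2
  have h3 : ‖x - p‖ = 0 := pow_eq_zero_iff two_ne_zero |>.1 (le_antisymm (by linarith) (sq_nonneg _))
  have h4 : x = p := by rwa [norm_eq_zero, sub_eq_zero] at h3
  subst h4
  rw [sub_self] at h1
  rwa [← eq_neg_of_add_eq_zero_left h1]

/-! ### Weak cluster points and Opial's lemma. -/

/-- Banach–Alaoglu through the Riesz isomorphism; ultrafilters replace subsequences, so separability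
plays no role. -/
theorem exists_ultrafilter_tendsto_inner [CompleteSpace X] {x : ℕ → X} {R : ℝ}
    (hx : ∀ n, ‖x n‖ ≤ R) (U : Ultrafilter ℕ) :
    ∃ z : X, ∀ h, Tendsto (fun n => inner ℝ (x n) h) U (𝓝 (inner ℝ z h)) := by
  set f : ℕ → WeakDual ℝ X := fun n =>
    StrongDual.toWeakDual (InnerProductSpace.toDual ℝ X (x n)) with hf
  obtain ⟨φ, -, hφ⟩ := (WeakDual.isCompact_closedBall (0 : StrongDual ℝ X) R).ultrafilter_le_nhds
    (U.map f) (by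
      rw [le_principal_iff]
      refine Ultrafilter.mem_map.2 (Eventually.of_forall fun n => ?_)
      change InnerProductSpace.toDual ℝ X (x n) ∈ Metric.closedBall 0 R
      rw [mem_closedBall_zero_iff, LinearIsometryEquiv.norm_map]
      exact hx n)
  refine ⟨(InnerProductSpace.toDual ℝ X).symm (WeakDual.toStrongDual φ), fun h => ?_⟩
  rw [InnerProductSpace.toDual_symm_apply]
  exact ((WeakDual.eval_continuous h).tendsto φ).comp hφ

theorem tendsto_toWeakSpace_of_inner [CompleteSpace X] {ι : Type*} {l : Filter ι} {x : ι → X}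
    {z : X} (h : ∀ w, Tendsto (fun n => inner ℝ (x n) w) l (𝓝 (inner ℝ z w))) :
    Tendsto (fun n => toWeakSpace ℝ X (x n)) l (𝓝 (toWeakSpace ℝ X z)) := by
  have hind : IsInducing fun (u : WeakBilin (topDualPairing ℝ X).flip) (φ : StrongDual ℝ X) =>
      (topDualPairing ℝ X).flip u φ := ⟨rfl⟩
  refine hind.tendsto_nhds_iff.2 (tendsto_pi_nhds.2 fun φ => ?_)
  have := h ((InnerProductSpace.toDual ℝ X).symm φ)
  simp only [real_inner_comm ((InnerProductSpace.toDual ℝ X).symm φ),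
    InnerProductSpace.toDual_symm_apply] at this
  exact this

/-- Opial's lemma, with weak cluster points described by ultrafilters. -/
theorem exists_tendsto_toWeakSpace [CompleteSpace X] {Z : Set X} (hne : Z.Nonempty) {x : ℕ → X}
    (hconv : ∀ z ∈ Z, ∃ l, Tendsto (fun n => ‖x n - z‖) atTop (𝓝 l))
    (hcl : ∀ (U : Ultrafilter ℕ) (z : X), (U : Filter ℕ) ≤ atTop →
      (∀ h, Tendsto (fun n => inner ℝ (x n) h) U (𝓝 (inner ℝ z h))) → z ∈ Z) :
    ∃ z ∈ Z, Tendsto (fun n => toWeakSpace ℝ X (x n)) atTop (𝓝 (toWeakSpace ℝ X z)) := by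
  obtain ⟨R, hR⟩ : ∃ R, ∀ n, ‖x n‖ ≤ R := by
    obtain ⟨z, hz⟩ := hne
    obtain ⟨l, hl⟩ := hconv z hz
    obtain ⟨R, hR⟩ := hl.bddAbove_range
    refine ⟨R + ‖z‖, fun n => ?_⟩
    have h1 : ‖x n - z‖ ≤ R := hR ⟨n, rfl⟩
    have h2 := norm_add_le (x n - z) z
    rw [sub_add_cancel] at h2
    linarith
  have huniq : ∀ (U V : Ultrafilter ℕ) (z w : X), (U : Filter ℕ) ≤ atTop → (V : Filter ℕ) ≤ atTop →
      (∀ h, Tendsto (fun n => inner ℝ (x n) h) U (𝓝 (inner ℝ z h))) →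
      (∀ h, Tendsto (fun n => inner ℝ (x n) h) V (𝓝 (inner ℝ w h))) → z = w := by
    intro U V z w hU hV hz hw
    obtain ⟨l, hl⟩ := hconv z (hcl U z hU hz)
    obtain ⟨k, hk⟩ := hconv w (hcl V w hV hw)
    -- `‖x n - w‖² - ‖x n - z‖²` is affine in `⟨x n, z - w⟩`, which therefore converges along the
    -- whole sequence; its limits along `U` and `V` agree.
    have hlim : Tendsto (fun n => inner ℝ (x n) (z - w)) atTop
        (𝓝 ((k ^ 2 - l ^ 2 + ‖z‖ ^ 2 - ‖w‖ ^ 2) / 2)) := by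
      have := ((((hk.pow 2).sub (hl.pow 2)).add_const (‖z‖ ^ 2)).sub_const (‖w‖ ^ 2)).div_const 2
      refine this.congr fun n => ?_
      rw [norm_sub_sq_real, norm_sub_sq_real, inner_sub_right]
      ring
    have h1 := tendsto_nhds_unique (hz (z - w)) (hlim.mono_left hU)
    have h2 := tendsto_nhds_unique (hw (z - w)) (hlim.mono_left hV)
    rw [← sub_eq_zero, ← inner_self_eq_zero (𝕜 := ℝ), inner_sub_left, h1, h2, sub_self]
  obtain ⟨z, hz⟩ := exists_ultrafilter_tendsto_inner hR (Ultrafilter.of atTop)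
  refine ⟨z, hcl _ z (Ultrafilter.of_le _) hz, tendsto_toWeakSpace_of_inner fun h => ?_⟩
  rw [tendsto_iff_ultrafilter]
  intro V hV
  obtain ⟨w, hw⟩ := exists_ultrafilter_tendsto_inner hR V
  rw [huniq _ V z w (Ultrafilter.of_le _) hV hz hw]
  exact hw h

/-! ### Averages with finite memory. -/

theorem tendsto_sub_of_tendsto_succ_sub {X : Type*} [NormedAddCommGroup X] {x : ℕ → X}
    (hx : Tendsto (fun n => x (n + 1) - x n) atTop (𝓝 0)) (i : ℕ) :
    Tendsto (fun n => x (n - i) - x n) atTop (𝓝 0) := by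
  have h : Tendsto (fun n => x (n + i) - x n) atTop (𝓝 0) := by
    induction i with
    | zero => simp
    | succ i ih =>
      have := ((tendsto_add_atTop_iff_nat i).2 hx).add ih
      rw [add_zero] at this
      refine this.congr fun n => ?_
      rw [sub_add_sub_cancel, add_assoc]
  have h' := (h.comp (tendsto_sub_atTop_nat i)).neg
  rw [neg_zero] at h'
  refine h'.congr' ?_
  filter_upwards [eventually_ge_atTop i] with n hn
  simp only [Function.comp_apply, Nat.sub_add_cancel hn, neg_sub]

/-- Affine combinations with finite memory of an asymptotically regular sequence stay
asymptotically close to it. -/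
theorem tendsto_sum_memory_sub {X : Type*} [NormedAddCommGroup X] [NormedSpace ℝ X] {x : ℕ → X} {m : ℕ} {μ : ℕ → ℕ → ℝ}
    (hx : Tendsto (fun n => x (n + 1) - x n) atTop (𝓝 0))
    (hμ_memory : ∀ n j : ℕ, m < n → j + m + 1 ≤ n → μ n j = 0)
    (hμ_sum : ∀ n : ℕ, ∑ j ∈ Finset.range (n + 1), μ n j = 1)
    (hμ_bdd : ∃ C : ℝ, ∀ n j : ℕ, j ≤ n → |μ n j| ≤ C) :
    Tendsto (fun n => ∑ j ∈ Finset.range (n + 1), μ n j • x j - x n) atTop (𝓝 0) := by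
  obtain ⟨C, hC⟩ := hμ_bdd
  have hlim : Tendsto (fun n => ∑ i ∈ Finset.range (m + 1), C * ‖x (n - i) - x n‖) atTop (𝓝 0) := by
    have := tendsto_finsetSum (Finset.range (m + 1)) fun i _ =>
      ((tendsto_sub_of_tendsto_succ_sub hx i).norm.const_mul C)
    simpa using this
  refine squeeze_zero_norm' ?_ hlim
  filter_upwards [eventually_gt_atTop m] with n hn
  have e : ∑ j ∈ Finset.range (n + 1), μ n j • x j - x n =
      ∑ i ∈ Finset.range (m + 1), μ n (n - i) • (x (n - i) - x n) := by
    have e1 : ∑ j ∈ Finset.range (n + 1), μ n j • x j - x n =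
        ∑ j ∈ Finset.range (n + 1), μ n j • (x j - x n) := by
      simp only [smul_sub, Finset.sum_sub_distrib, ← Finset.sum_smul, hμ_sum, one_smul]
    -- Indexing by the lag `i = n - j` leaves the fixed number `m + 1` of possibly nonzero terms.
    rw [e1, ← Finset.sum_range_reflect, Nat.add_sub_cancel]
    symm
    refine Finset.sum_subset (Finset.range_mono (by omega)) fun i hi hi' => ?_
    rw [Finset.mem_range] at hi hi'
    rw [hμ_memory n (n - i) hn (by omega), zero_smul]
  rw [e]
  refine (norm_sum_le _ _).trans (Finset.sum_le_sum fun i _ => ?_)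
  rw [norm_smul, Real.norm_eq_abs]
  gcongr
  exact hC n _ (Nat.sub_le _ _)

/-! ### Relaxed projections onto a half-space. -/

/-- With `c` the coefficient of `s` and `δ = ⟨y - x, s⟩`, the squared step is `r c δ` and the
squared distance to `z` drops by at least `(2 - r) c δ`. -/
theorem relaxed_projection_norm_sq_le {x y z s : X} {r L : ℝ} (hr : r ∈ Ioo (0 : ℝ) 2)
    (hrL : r ≤ L) (hL : L < 2) (hz : 0 ≤ inner ℝ (y - z) s) (hδ : inner ℝ (y - x) s < 0) :
    ‖x + (r * inner ℝ (y - x) s / ‖s‖ ^ 2) • s - z‖ ^ 2 +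
      (2 - L) / 2 * ‖(r * inner ℝ (y - x) s / ‖s‖ ^ 2) • s‖ ^ 2 ≤ ‖x - z‖ ^ 2 := by
  have hs : s ≠ 0 := by rintro rfl; simp at hδ
  have hs' : 0 < ‖s‖ ^ 2 := by positivity
  set δ := inner ℝ (y - x) s with hδdef
  have h1 : inner ℝ (x - z) s = inner ℝ (y - z) s - δ := by
    rw [hδdef, ← inner_sub_left]; congr 1; abel
  rw [add_sub_right_comm, norm_add_sq_real, real_inner_smul_right, h1, norm_smul, mul_pow,
    Real.norm_eq_abs, sq_abs]
  set c := r * δ / ‖s‖ ^ 2 with hc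
  have hcs : c * ‖s‖ ^ 2 = r * δ := by rw [hc]; field_simp
  have hc0 : c ≤ 0 := div_nonpos_of_nonpos_of_nonneg
    (mul_nonpos_of_nonneg_of_nonpos hr.1.le hδ.le) hs'.le
  have h2 : c ^ 2 * ‖s‖ ^ 2 = r * (c * δ) := by rw [sq, mul_assoc, hcs]; ring
  have h3 : 0 ≤ c * δ := mul_nonneg_of_nonpos_of_nonpos hc0 hδ.le
  have h4 : c * inner ℝ (y - z) s ≤ 0 := mul_nonpos_of_nonpos_of_nonneg hc0 hz
  rw [h2]
  have h5 : (2 - L) / 2 * r ≤ 2 - r := by nlinarith [hr.1, hr.2]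
  nlinarith [mul_le_mul_of_nonneg_right h5 h3]

theorem relaxed_projection_inner_le {x y s : X} {r l : ℝ} (hl : 0 < l) (hlr : l ≤ r)
    (hδ : inner ℝ (y - x) s < 0) :
    l * inner ℝ (x - y) s ≤ ‖(r * inner ℝ (y - x) s / ‖s‖ ^ 2) • s‖ * ‖s‖ := by
  have hs : s ≠ 0 := by rintro rfl; simp at hδ
  have hs' : 0 < ‖s‖ := by positivity
  have e : inner ℝ (x - y) s = -inner ℝ (y - x) s := by rw [← inner_neg_left, neg_sub]
  rw [e, norm_smul, Real.norm_eq_abs, abs_div, abs_mul, abs_of_neg hδ,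
    abs_of_pos (hl.trans_le hlr), abs_of_pos (pow_pos hs' 2)]
  have : r * -inner ℝ (y - x) s / ‖s‖ ^ 2 * ‖s‖ * ‖s‖ = r * -inner ℝ (y - x) s := by
    field_simp
  rw [this]
  exact mul_le_mul_of_nonneg_right hlr (by linarith)

end SetOp

/-! ### Convergence of the algorithm. -/

open SetOp in
theorem corollary5p2 {X : Type*} [NormedAddCommGroup X] [InnerProductSpace ℝ X] [CompleteSpace X]
    (A : X → Set X) (hA : SetOp.IsMaximallyMonotone A)
    (B : X → X) (hB : SetOp.IsMonotone (SetOp.single B))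
    (β : ℝ≥0) (hβ : 0 < β) (hBlip : LipschitzWith β B)
    (α : ℝ) (hα : 0 < α) (χ : ℝ≥0) (hχ : 0 < χ)
    (ε : ℝ) (hε : ε ∈ Ioo 0 (α / ((β : ℝ) + 1)))
    (W : ℕ → X → X) (hWmono : ∀ n, SetOp.IsStronglyMonotone α (W n))
    (hWlip : ∀ n, LipschitzWith χ (W n))
    (γ : ℕ → ℝ) (hγ : ∀ n, γ n ∈ Icc ε ((α - ε) / (β : ℝ)))
    (lam : ℕ → ℝ) (hlam : ∀ n, lam n ∈ Ioo (0 : ℝ) 2)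
    (hlam_inf : 0 < ⨅ n, lam n) (hlam_sup : ⨆ n, lam n < 2)
    (e : ℕ → X) (he : Tendsto e atTop (𝓝 0))
    (m : ℕ) (hm : m ≠ 0)
    (μ : ℕ → ℕ → ℝ)
    (hμ_memory : ∀ n j : ℕ, m < n → j + m + 1 ≤ n → μ n j = 0)
    (hμ_sum : ∀ n : ℕ, ∑ j ∈ Finset.range (n + 1), μ n j = 1)
    (hμ_bdd : ∃ C : ℝ, ∀ n j : ℕ, j ≤ n → |μ n j| ≤ C) :
    -- the operators `(Wₙ + γₙ A)⁻¹` are single-valued with full domain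
    (∀ (n : ℕ) (u : X), ∃! p : X, p ∈ SetOp.inverse (SetOp.single (W n) + γ n • A) u) ∧
    -- every sequence generated by the algorithm has the asserted asymptotic behaviour
    ((SetOp.zer (A + SetOp.single B)).Nonempty →
      ∀ x xt v y ys : ℕ → X, SetOp.IsFBFIteration A B W γ lam e μ x xt v y ys →
        Summable (fun n => ‖x (n + 1) - x n‖ ^ 2) ∧
        ∃ z ∈ SetOp.zer (A + SetOp.single B),
          Tendsto (fun n => toWeakSpace ℝ X (x n)) atTop (𝓝 (toWeakSpace ℝ X z))) := by
  have hβ' : (0 : ℝ) < β := by exact_mod_cast hβ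
  have hε0 : 0 < ε := hε.1
  have hγ0 : ∀ n, 0 < γ n := fun n => hε0.trans_le (hγ n).1
  refine ⟨fun n u => ?_, fun hne x xt v y ys hit => ?_⟩
  · obtain ⟨p, a, ha, hp⟩ := hA.exists_map_add_smul_eq hα (hWmono n) (hWlip n) (hγ0 n) u
    refine ⟨p, mem_inverse_single_add_smul.2 ⟨a, ha, hp⟩, fun q hq => ?_⟩
    obtain ⟨b, hb, hq⟩ := mem_inverse_single_add_smul.1 hq
    exact hA.1.eq_of_add_smul_eq hα (hWmono n) (hγ0 n) hb ha (hq.trans hp.symm)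
  have hεα : ε * β + ε < α := by
    have := hε.2
    rw [lt_div_iff₀ (by positivity)] at this
    linarith
  set l := ⨅ n, lam n with hl
  set L := ⨆ n, lam n with hL
  have hll : ∀ n, l ≤ lam n := fun n => ciInf_le ⟨0, by rintro _ ⟨k, rfl⟩; exact (hlam k).1.le⟩ n
  have hLL : ∀ n, lam n ≤ L := fun n => le_ciSup ⟨2, by rintro _ ⟨k, rfl⟩; exact (hlam k).2.le⟩ n
  -- `ys n` belongs to `(A + B) (y n)`
  have hys : ∀ n, ys n - B (y n) ∈ A (y n) := by
    intro n
    obtain ⟨a, ha, h⟩ := mem_inverse_single_add_smul.1 (hit.y_mem n)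
    rw [hit.ys_eq, add_sub_cancel_right, ← h, add_sub_cancel_left, inv_smul_smul₀ (hγ0 n).ne']
    exact ha
  have hmono : ∀ n, ∀ p, ∀ a ∈ A p, 0 ≤ inner ℝ (y n - p) (ys n - (a + B p)) := by
    intro n p a ha
    have h1 := hA.1 (y n, _) (hys n) (p, a) ha
    have h2 := isMonotone_single_iff.1 hB (y n) p
    have h3 : ys n - (a + B p) = (ys n - B (y n) - a) + (B (y n) - B p) := by abel
    rw [h3, inner_add_right]
    exact add_nonneg h1 h2
  have hzer : ∀ z ∈ zer (A + single B), ∀ n, 0 ≤ inner ℝ (y n - z) (ys n) := by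
    intro z hz n
    have := hmono n z _ (mem_zer_add_single.1 hz)
    rwa [neg_add_cancel, sub_zero] at this
  set c := (2 - L) / 2 with hc
  have hc0 : 0 < c := by rw [hc]; linarith
  have hfejer : ∀ z ∈ zer (A + single B), ∀ n,
      ‖x (n + 1) - z‖ ^ 2 + c * ‖x (n + 1) - x n‖ ^ 2 ≤ ‖x n - z‖ ^ 2 := by
    intro z hz n
    by_cases h : inner ℝ (y n - x n) (ys n) < 0
    · have := relaxed_projection_norm_sq_le (hlam n) (hLL n) hlam_sup (hzer z hz n) h
      rw [hit.x_step n h, add_sub_cancel_left]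
      exact this
    · rw [hit.x_stay n h]
      simp
  have hsum : Summable (fun n => ‖x (n + 1) - x n‖ ^ 2) := by
    obtain ⟨z, hz⟩ := hne
    refine summable_of_sum_range_le (c := ‖x 0 - z‖ ^ 2 / c) (fun n => sq_nonneg _) fun n => ?_
    have : ‖x n - z‖ ^ 2 + c * ∑ k ∈ Finset.range n, ‖x (k + 1) - x k‖ ^ 2 ≤ ‖x 0 - z‖ ^ 2 := by
      induction n with
      | zero => simp
      | succ n ih =>
        rw [Finset.sum_range_succ, mul_add]
        linarith [hfejer z hz n]
    rw [le_div_iff₀ hc0]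
    linarith [sq_nonneg ‖x n - z‖]
  refine ⟨hsum, ?_⟩
  have hstep : Tendsto (fun n => x (n + 1) - x n) atTop (𝓝 0) := by
    rw [tendsto_zero_iff_norm_tendsto_zero]
    have := (Real.continuous_sqrt.tendsto _).comp hsum.tendsto_atTop_zero
    rw [Real.sqrt_zero] at this
    exact this.congr fun n => Real.sqrt_sq (norm_nonneg _)
  have hxt : Tendsto (fun n => xt n - x n) atTop (𝓝 0) := by
    have := he.add (tendsto_sum_memory_sub hstep hμ_memory hμ_sum hμ_bdd)
    rw [add_zero] at this
    refine this.congr fun n => ?_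
    rw [hit.xt_eq, add_sub_assoc]
  have hinner : ∀ n, l * inner ℝ (x n - y n) (ys n) ≤ ‖x (n + 1) - x n‖ * ‖ys n‖ := by
    intro n
    by_cases h : inner ℝ (y n - x n) (ys n) < 0
    · rw [hit.x_step n h, add_sub_cancel_left]
      exact relaxed_projection_inner_le hlam_inf (hll n) h
    · rw [hit.x_stay n h, sub_self, norm_zero, zero_mul, ← neg_sub, inner_neg_left]
      exact mul_nonpos_of_nonneg_of_nonpos hlam_inf.le (by linarith)
  set M := χ / ε + β with hM
  have hM0 : 0 ≤ M := by positivity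
  -- Chosen so that `κ + β ≤ α / γ n`, which follows from `γ n * β ≤ α - ε`: strong monotonicity of
  -- `W n` then dominates the Lipschitz term of `B`.
  set κ := ε * β / α with hκ
  have hκ0 : 0 < κ := by positivity
  have hys' : ∀ n, ys n = (γ n)⁻¹ • (W n (xt n) - W n (y n)) - (B (xt n) - B (y n)) := by
    intro n
    rw [hit.ys_eq, hit.v_eq, sub_right_comm, smul_sub, inv_smul_smul₀ (hγ0 n).ne']
    abel
  have hysM : ∀ n, ‖ys n‖ ≤ M * ‖xt n - y n‖ := by
    intro n
    have h1 : ‖W n (xt n) - W n (y n)‖ ≤ χ * ‖xt n - y n‖ := by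
      simpa [dist_eq_norm] using (hWlip n).dist_le_mul (xt n) (y n)
    have h2 : ‖B (xt n) - B (y n)‖ ≤ β * ‖xt n - y n‖ := by
      simpa [dist_eq_norm] using hBlip.dist_le_mul (xt n) (y n)
    rw [hys', hM, add_mul]
    refine (norm_sub_le _ _).trans (add_le_add ?_ h2)
    rw [norm_smul, norm_inv, Real.norm_eq_abs, abs_of_pos (hγ0 n), div_eq_inv_mul, mul_assoc]
    have h3 : (γ n)⁻¹ ≤ ε⁻¹ := inv_anti₀ hε0 (hγ n).1
    gcongr
  have hyslow : ∀ n, κ * ‖xt n - y n‖ ^ 2 ≤ inner ℝ (xt n - y n) (ys n) := by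
    intro n
    have h1 := hWmono n (xt n) (y n)
    have h2 : inner ℝ (xt n - y n) (B (xt n) - B (y n)) ≤ β * ‖xt n - y n‖ ^ 2 := by
      have h2 : ‖B (xt n) - B (y n)‖ ≤ β * ‖xt n - y n‖ := by
        simpa [dist_eq_norm] using hBlip.dist_le_mul (xt n) (y n)
      nlinarith [real_inner_le_norm (xt n - y n) (B (xt n) - B (y n)), norm_nonneg (xt n - y n)]
    have h3 : γ n * β ≤ α - ε := (le_div_iff₀ hβ').1 (hγ n).2
    have h4 : κ + β ≤ (γ n)⁻¹ * α := by
      have h5 : γ n * κ ≤ ε := by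
        rw [hκ, mul_div_assoc', div_le_iff₀ hα]
        nlinarith
      rw [inv_mul_eq_div, le_div_iff₀ (hγ0 n)]
      linarith
    rw [hys', inner_sub_right, real_inner_smul_right]
    have h6 := mul_le_mul_of_nonneg_left h1 (inv_nonneg.2 (hγ0 n).le)
    have h7 := mul_le_mul_of_nonneg_right h4 (sq_nonneg ‖xt n - y n‖)
    linarith
  have hxty : Tendsto (fun n => xt n - y n) atTop (𝓝 0) := by
    refine squeeze_zero_norm (a := fun n =>
      M / κ * (‖x (n + 1) - x n‖ / l + ‖xt n - x n‖)) (fun n => ?_) ?_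
    · rcases (norm_nonneg (xt n - y n)).eq_or_lt with h0 | h0
      · rw [← h0]; positivity
      have h1 : inner ℝ (x n - y n) (ys n) ≤ ‖x (n + 1) - x n‖ / l * ‖ys n‖ := by
        rw [div_mul_eq_mul_div, le_div_iff₀ hlam_inf, mul_comm]
        exact hinner n
      -- Between `hyslow` and `hysM`, one factor `‖xt n - y n‖` cancels and leaves a bound that
      -- tends to zero.
      have h2 : inner ℝ (xt n - y n) (ys n) ≤ (‖x (n + 1) - x n‖ / l + ‖xt n - x n‖) * ‖ys n‖ := by
        rw [← sub_add_sub_cancel (xt n) (x n) (y n), inner_add_left]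
        linarith [real_inner_le_norm (xt n - x n) (ys n)]
      have h3 := mul_le_mul_of_nonneg_left (hysM n)
        (show 0 ≤ ‖x (n + 1) - x n‖ / l + ‖xt n - x n‖ by positivity)
      have h4 : (κ * ‖xt n - y n‖) * ‖xt n - y n‖ ≤
          (M * (‖x (n + 1) - x n‖ / l + ‖xt n - x n‖)) * ‖xt n - y n‖ := by
        linarith [hyslow n]
      rw [div_mul_eq_mul_div, le_div_iff₀ hκ0, mul_comm]
      exact le_of_mul_le_mul_right h4 h0
    · have := ((hstep.norm.div_const l).add hxt.norm).const_mul (M / κ)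
      simpa using this
  have hys0 : Tendsto ys atTop (𝓝 0) := by
    refine squeeze_zero_norm hysM ?_
    simpa using hxty.norm.const_mul M
  have hyx : Tendsto (fun n => y n - x n) atTop (𝓝 0) := by
    have := hxt.sub hxty
    rw [sub_zero] at this
    exact this.congr fun n => by abel
  have hconv : ∀ z ∈ zer (A + single B), ∃ l, Tendsto (fun n => ‖x n - z‖) atTop (𝓝 l) := by
    intro z hz
    refine ⟨_, tendsto_atTop_ciInf (antitone_nat_of_succ_le fun n => ?_)
      ⟨0, by rintro _ ⟨n, rfl⟩; exact norm_nonneg _⟩⟩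
    apply le_of_sq_le_sq _ (norm_nonneg _)
    nlinarith [hfejer z hz n, sq_nonneg ‖x (n + 1) - x n‖]
  refine exists_tendsto_toWeakSpace hne hconv fun U z hU hz => ?_
  refine hA.mem_zer_add_single hB hBlip fun p a ha => ?_
  obtain ⟨R, hR⟩ : ∃ R, ∀ n, ‖x n - p‖ ≤ R := by
    obtain ⟨w, hw⟩ := hne
    obtain ⟨_, hk⟩ := hconv w hw
    obtain ⟨R, hR⟩ := hk.bddAbove_range
    refine ⟨R + ‖w - p‖, fun n => ?_⟩
    have h1 : ‖x n - w‖ ≤ R := hR ⟨n, rfl⟩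
    linarith [norm_sub_le_norm_sub_add_norm_sub (x n) w p]
  have hlim1 : Tendsto (fun n => inner ℝ (x n - p) (-(a + B p))) U
      (𝓝 (inner ℝ (z - p) (-(a + B p)))) := by
    simp only [inner_sub_left]
    exact (hz _).sub_const _
  have hlim2 : Tendsto (fun n => inner ℝ (y n - x n) (ys n - (a + B p))) U (𝓝 0) := by
    have := (hyx.inner (𝕜 := ℝ) (hys0.sub_const (a + B p))).mono_left hU
    rwa [inner_zero_left] at this
  have hlim3 : Tendsto (fun n => inner ℝ (x n - p) (ys n)) U (𝓝 0) := by
    refine (squeeze_zero_norm (a := fun n => R * ‖ys n‖) (fun n => ?_) ?_).mono_left hU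
    · exact (norm_inner_le_norm _ _).trans (by gcongr; exact hR n)
    · simpa using hys0.norm.const_mul R
  -- The three terms add up to `⟨y n - p, ys n - (a + B p)⟩`, nonnegative by `hmono`; only the first
  -- survives in the limit.
  have hlim := (hlim1.add hlim2).add hlim3
  rw [add_zero, add_zero] at hlim
  refine ge_of_tendsto' hlim fun n => ?_
  have h := hmono n p a ha
  rw [← sub_add_sub_cancel (y n) (x n) p, inner_add_left] at h
  have h' : inner ℝ (x n - p) (ys n - (a + B p)) =
      inner ℝ (x n - p) (ys n) + inner ℝ (x n - p) (-(a + B p)) := by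
    rw [← inner_add_right, ← sub_eq_add_neg]
  linarith
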